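/- Let $\delta\ge 1$, let $\Sigma$ be a finite set, and let $\Pi=(\delta,\Sigma,\mathcal C)$ with $\mathcal C\subseteq\Sigma^{\delta+1}$ be an LCL problem: in a rooted tree, a labeling $\lambda$ of the nodes by $\Sigma$ is a solution if for each node $v$ with $\delta$ children, the children can be ordered as $v_1,\dots,v_\delta$ so that $(\lambda(v):\lambda(v_1),\dots,\lambda(v_\delta))\in\mathcal C$. A uniform certificate of $O(\log^* n)$ solvability for $\Pi$ consists of a non-empty set of labels $\Sigma_{\mathcal T}=\{\sigma_0,\dots,\sigma_t\}\subseteq\Sigma$, a depth $d\ge 1$, and labeled complete $\delta$-ary trees $\mathcal T_0,\dots,\mathcal T_t$ of depth $d$ such that (1) all labels used in the trees lie in $\Sigma_{\mathcal T}$, and each $\mathcal T_i$ is correctly labeled with respect to $\mathcal C$; (2) after removing the labels of all non-leaf nodes, the trees are pairwise isomorphic by isomorphisms of rooted trees that preserve the labels of the leaves; (3) the root of $\mathcal T_i$ has label $\sigma_i$. A coprime certificate of $O(\log^* n)$ solvability for $\Pi$ consists of a non-empty set of labels $\Sigma_{\mathcal T}=\{\sigma_0,\dots,\sigma_t\}\subseteq\Sigma$,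 two coprime depths $d_1,d_2\ge 1$, and two sequences $\mathcal T^1_0,\dots,\mathcal T^1_t$ and $\mathcal T^2_0,\dots,\mathcal T^2_t$ of complete $\delta$-ary trees of depth $d_1$ and $d_2$ respectively, labeled from $\Sigma$ with all leaves labeled from $\Sigma_{\mathcal T}$, each correctly labeled with respect to $\mathcal C$, such that each of the two sequences satisfies (2) and (3). **Theorem.** If a uniform or a coprime certificate of $O(\log^* n)$ solvability for $\Pi$ exists, then $\Pi$ can be solved on full $\delta$-ary rooted trees (each node has exactly $\delta$ or $0$ children) by a deterministic algorithm in $O(\log^* n)$ rounds in the CONGEST model. That is, for each polynomial $p$ there is a deterministic synchronous message-passing algorithm that, on each full $\delta$-ary rooted tree with $n$ nodes, with distinct identifiers from $\{1,\dots,p(n)\}$, sends only messages of $O(\log n)$ bits and after $O(\log^* n)$ rounds has produced an output at each node, these outputs forming a solution of $\Pi$. Initially each node knows its identifier, its degree, $n$, the maximum degree of the tree, and which of its incident edges leads to its parent. The constants in the $O$-notation may depend on $\Pi$ and $p$. -/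

import Mathlib

namespace TreeLCL

/-! ### LCL problems on full `δ`-ary trees -/

/-- An LCL problem with `δ` children and label set `L`: a set of allowed configurations
`(a : b₁, …, b_δ)`. -/
structure LCL (δ : ℕ) (L : Type) where
  configs : Set (L × (Fin δ → L))

/-- The parent label `a` and the (unordered) children labels `b` form an allowed configuration. -/
def LCL.Allows {δ : ℕ} {L : Type} (P : LCL δ L) (a : L) (b : Fin δ → L) : Prop :=
  ∃ ρ : Equiv.Perm (Fin δ), (a, fun i => b (ρ i)) ∈ P.configs

/-! ### Input graphs: rooted trees -/

/-- A rooted tree on the node set `V`, given by its parent function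
(with the convention that the parent pointer of the root points to the root itself). -/
structure RootedTree (V : Type) where
  root : V
  parent : V → V
  parent_root : parent root = root
  reaches_root : ∀ v, ∃ k : ℕ, parent^[k] v = root

namespace RootedTree

variable {V : Type} (G : RootedTree V)

/-- `w` is a child of `v`. -/
def IsChild (v w : V) : Prop := w ≠ G.root ∧ G.parent w = v

noncomputable def numChildren (v : V) : ℕ := {w | G.IsChild v w}.ncard

/-- Every node has either exactly `δ` or `0` children. -/
def IsFull (δ : ℕ) : Prop := ∀ v, G.numChildren v = δ ∨ G.numChildren v = 0

open Classical in
/-- The number of edges incident to `v`. -/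
noncomputable def degree (v : V) : ℕ := G.numChildren v + if v = G.root then 0 else 1

noncomputable def maxDegree [Fintype V] : ℕ := Finset.univ.sup G.degree

end RootedTree

/-- A labeling `lab` of the tree solves `P`: at every node with `δ` children,
the label of the node and those of its children form an allowed configuration. -/
def LCL.IsSolution {δ : ℕ} {L V : Type} (P : LCL δ L) (G : RootedTree V) (lab : V → L) : Prop :=
  ∀ (v : V) (child : Fin δ ≃ {w // G.IsChild v w}), P.Allows (lab v) (fun i => lab (child i))

/-! ### Deterministic message passing and the CONGEST model -/

/-- What a node knows before the first round. -/
structure LocalInput where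
  /-- the number of nodes of the graph -/
  n : ℕ
  /-- the maximum degree of the graph -/
  maxDegree : ℕ
  /-- the node's own identifier -/
  ident : ℕ
  /-- whether one of the incident edges leads to a parent (false exactly at the root) -/
  hasParent : Bool
  /-- the number of incident edges that lead to children -/
  numChildren : ℕ

/-- The local names of the edges at a node: `none` is the edge to the parent,
`some i` is the edge to the `i`-th child. -/
abbrev Port (δ : ℕ) : Type := Option (Fin δ)

/-- A deterministic synchronous message-passing algorithm on rooted trees in which nodes have at
most `δ` children, with outputs in `L`. Messages are bit strings. In each round every node sends
a message on each of its edges, computed from its state, and updates its state from the messages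
it receives (`none` at a port without an edge). Outputs are irrevocable. -/
structure Algorithm (δ : ℕ) (L : Type) where
  State : Type
  init : LocalInput → State
  send : State → Port δ → List Bool
  update : State → (Port δ → Option (List Bool)) → State
  output : State → Option L
  output_stable : ∀ s inbox a, output s = some a → output (update s inbox) = some a

/-- An instance: a rooted tree with node identifiers, and at each node an arbitrary numbering of
its edges to children; `port w` is the number that the parent of `w` uses for its edge to `w`
(the value at the root is never used). -/
structure Network (δ : ℕ) (V : Type) where
  tree : RootedTree V
  ident : V → ℕ
  ident_injective : Function.Injective ident
  port : V → Fin δ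
  port_injective : ∀ u v w, tree.IsChild u v → tree.IsChild u w → port v = port w → v = w

namespace Network

variable {δ : ℕ} {L V : Type} (N : Network δ V)

open Classical in
/-- The neighbor of `v` across the port `q`, if there is an edge at that port. -/
noncomputable def neighbor (v : V) : Port δ → Option V
  | none => if v = N.tree.root then none else some (N.tree.parent v)
  | some i => if h : ∃ w, N.tree.IsChild v w ∧ N.port w = i then some h.choose else none

/-- The port under which the neighbor across the port `q` of `v` knows the same edge. -/
def reversePort (v : V) : Port δ → Port δ
  | none => some (N.port v)
  | some _ => none

open Classical in
noncomputable def localInput [Fintype V] (v : V) : LocalInput where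
  n := Fintype.card V
  maxDegree := N.tree.maxDegree
  ident := N.ident v
  hasParent := decide (v ≠ N.tree.root)
  numChildren := N.tree.numChildren v

/-- The state of each node after `t` rounds. -/
noncomputable def state [Fintype V] (A : Algorithm δ L) : ℕ → V → A.State
  | 0, v => A.init (N.localInput v)
  | t + 1, v => A.update (state A t v) fun q =>
      (N.neighbor v q).map fun w => A.send (state A t w) (N.reversePort v q)

end Network

/-- The iterated logarithm: the least `k` such that applying `log₂` to `n` `k` times gives a
number that is at most `1`. -/
noncomputable def logStar (n : ℕ) : ℕ := sInf {k : ℕ | (Real.logb 2)^[k] (n : ℝ) ≤ 1}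

open Asymptotics Filter in
/-- `P` can be solved by a deterministic algorithm in `O(f(n))` rounds in the CONGEST model:
for identifiers in `{1, …, p(n)}`, with `p` any polynomial, there are an algorithm `A`, a number
of rounds `T(n) = O(f(n))` and a bandwidth `B(n) = O(log n)` such that on each full `δ`-ary tree
with `n` nodes, for all identifiers and port numberings, all messages that `A` sends have at most
`B(n)` bits, and after `T(n)` rounds all nodes have produced an output, forming a solution. -/
def LCL.SolvableInCongest {δ : ℕ} {L : Type} (P : LCL δ L) (f : ℕ → ℝ) : Prop :=
  ∀ p : Polynomial ℕ, ∃ (A : Algorithm δ L) (T B : ℕ → ℕ),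
    (fun n => (T n : ℝ)) =O[atTop] f ∧
    (fun n => (B n : ℝ)) =O[atTop] (fun n : ℕ => Real.log n) ∧
    ∀ (V : Type) [Fintype V] (N : Network δ V), N.tree.IsFull δ →
      (∀ v, 1 ≤ N.ident v ∧ N.ident v ≤ p.eval (Fintype.card V)) →
      (∀ (t : ℕ) (v w : V) (q : Port δ), N.neighbor v q = some w →
        (A.send (N.state A t v) q).length ≤ B (Fintype.card V)) ∧
      ∃ lab : V → L, (∀ v, A.output (N.state A (T (Fintype.card V)) v) = some (lab v)) ∧
        P.IsSolution N.tree lab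

/-! ### Certificates -/

/-- Complete `δ`-ary trees of depth `d` with all nodes labeled from `L`. The children of a node
are listed in some order, which is immaterial for all notions below. -/
inductive LabeledTree (δ : ℕ) (L : Type) : ℕ → Type
  | leaf (a : L) : LabeledTree δ L 0
  | node {d : ℕ} (a : L) (children : Fin δ → LabeledTree δ L d) : LabeledTree δ L (d + 1)

namespace LabeledTree

variable {δ : ℕ} {L : Type}

def rootLabel : {d : ℕ} → LabeledTree δ L d → L
  | _, leaf a => a
  | _, node a _ => a

/-- All labels of the tree lie in `S`. -/
def LabelsIn (S : Set L) : {d : ℕ} → LabeledTree δ L d → Prop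
  | _, leaf a => a ∈ S
  | _, node a c => a ∈ S ∧ ∀ i, LabelsIn S (c i)

/-- All labels of leaves lie in `S`. -/
def LeafLabelsIn (S : Set L) : {d : ℕ} → LabeledTree δ L d → Prop
  | _, leaf a => a ∈ S
  | _, node _ c => ∀ i, LeafLabelsIn S (c i)

/-- The labeling is correct with respect to the configurations of `P`. -/
def Correct (P : LCL δ L) : {d : ℕ} → LabeledTree δ L d → Prop
  | _, leaf _ => True
  | _, node a c => P.Allows a (fun i => (c i).rootLabel) ∧ ∀ i, Correct P (c i)

/-- After removing the labels of all non-leaf nodes, the two trees are isomorphic as rooted trees,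
by an isomorphism that preserves the labels of the leaves. -/
def LeafIso : {d : ℕ} → LabeledTree δ L d → LabeledTree δ L d → Prop
  | _, leaf a, leaf b => a = b
  | _, node _ c, node _ c' => ∃ ρ : Equiv.Perm (Fin δ), ∀ i, LeafIso (c i) (c' (ρ i))

end LabeledTree

/-- A uniform certificate of `O(log* n)` solvability for `P`, with labels
`{σ 0, …, σ t}` and depth `d`. -/
structure UniformCertificate {δ : ℕ} {L : Type} (P : LCL δ L) where
  t : ℕ
  σ : Fin (t + 1) → L
  d : ℕ
  one_le_d : 1 ≤ d
  tree : Fin (t + 1) → LabeledTree δ L d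
  labels : ∀ i, (tree i).LabelsIn (Set.range σ)
  correct : ∀ i, (tree i).Correct P
  iso : ∀ i j, (tree i).LeafIso (tree j)
  root : ∀ i, (tree i).rootLabel = σ i

/-- A coprime certificate of `O(log* n)` solvability for `P`, with labels `{σ 0, …, σ t}` and
depth pair `(d₁, d₂)`. Leaves are labeled from `{σ 0, …, σ t}`; internal nodes may use any label. -/
structure CoprimeCertificate {δ : ℕ} {L : Type} (P : LCL δ L) where
  t : ℕ
  σ : Fin (t + 1) → L
  d₁ : ℕ
  d₂ : ℕ
  one_le_d₁ : 1 ≤ d₁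
  one_le_d₂ : 1 ≤ d₂
  coprime : Nat.Coprime d₁ d₂
  tree₁ : Fin (t + 1) → LabeledTree δ L d₁
  tree₂ : Fin (t + 1) → LabeledTree δ L d₂
  leaves₁ : ∀ i, (tree₁ i).LeafLabelsIn (Set.range σ)
  leaves₂ : ∀ i, (tree₂ i).LeafLabelsIn (Set.range σ)
  correct₁ : ∀ i, (tree₁ i).Correct P
  correct₂ : ∀ i, (tree₂ i).Correct P
  iso₁ : ∀ i j, (tree₁ i).LeafIso (tree₁ j)
  iso₂ : ∀ i j, (tree₂ i).LeafIso (tree₂ j)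
  root₁ : ∀ i, (tree₁ i).rootLabel = σ i
  root₂ : ∀ i, (tree₂ i).rootLabel = σ i

end TreeLCL

/-! Both certificates yield blocks (`IsBlock`) of every sufficiently large depth. Hanging trees
below the leaves of a block gives a block again (`IsBlock.glue`). Under a uniform certificate single
levels can be appended, because its labels stay in `S`. Under a coprime certificate every large
depth is a sum `x * d₁ + y * d₂`, realized by stacking blocks.

Suppose blocks exist for all depths at least `K`, and nodes are marked so that consecutive marks on
upward paths are between `K` and `2 * K` apart, with equal marks on nodes equally far below a common
ancestor, up to `2 * K` levels. The marks cut the tree into blocks. A marked node is a leaf of the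
block above it, so its label can be computed without knowing the root label of that block. The root
labels of all blocks are thus found independently of each other, and each interior is filled in from
its root label (`blockLabel_allows`).

The marks come from symmetry breaking on the sequence of identifiers of the ancestors. About `log*
n` rounds of bitwise color reduction, done for each distance up to `K`, leave boundedly many colors
that differ at distances below `K` (`exists_reduce_bound`, `distColor_ne`), and a greedy selection
by color gives the spacing. A greedy decision reaches only a bounded distance towards the node, so
moving the marks a constant number of levels down the tree makes them depend on ancestors alone,
consistently between parent and child (`selected_shift`). The marks just below a node are then known
to it and agree on all branches. Virtual ancestors above the root remove the boundary case.

So a label depends on `O(log* n)` entries of the path to the root, and these are pipelined down the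
tree, one entry per round (`pathAlgorithm_state`). -/

namespace TreeLCL

/-! ### Blocks -/

/-- Allowed configurations are invariant under reordering the children. -/
theorem LCL.Allows.comp_perm {δ : ℕ} {L : Type} {P : LCL δ L} {a : L} {b : Fin δ → L}
    (h : P.Allows a b) (π : Equiv.Perm (Fin δ)) : P.Allows a (fun i => b (π i)) := by
  obtain ⟨ρ, hρ⟩ := h
  exact ⟨ρ.trans π.symm, by simpa using hρ⟩

/-- `F` labels, for each root label in `S`, the complete tree of depth `k` correctly, with leaf
labels in `S`. Nodes are addressed by the list of the ports on the path to the root, the port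
closest to the node first. -/
structure IsExtension {δ : ℕ} {L : Type} (P : LCL δ L) (S : Set L) (k : ℕ)
    (F : L → List (Fin δ) → L) : Prop where
  nil : ∀ a ∈ S, F a [] = a
  allows : ∀ a ∈ S, ∀ l : List (Fin δ), l.length < k → P.Allows (F a l) (fun i => F a (i :: l))
  leaf_mem : ∀ a ∈ S, ∀ l : List (Fin δ), l.length = k → F a l ∈ S

/-- A family of correctly labeled trees of depth `k`, one for each root label in `S`, with leaf
labels in `S` that do not depend on the root label. -/
structure IsBlock {δ : ℕ} {L : Type} (P : LCL δ L) (S : Set L) (k : ℕ)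
    (F : L → List (Fin δ) → L) : Prop extends IsExtension P S k F where
  leaf_eq : ∀ a ∈ S, ∀ b ∈ S, ∀ l : List (Fin δ), l.length = k → F a l = F b l

section Blocks

variable {δ : ℕ} {L : Type} {P : LCL δ L} {S : Set L}

/-- Hang the trees of `F₂` below the leaves of the trees of depth `k` of `F₁`. -/
def glue (k : ℕ) (F₁ F₂ : L → List (Fin δ) → L) (a : L) (l : List (Fin δ)) : L :=
  if l.length < k then F₁ a l
  else F₂ (F₁ a (l.drop (l.length - k))) (l.take (l.length - k))

theorem IsExtension.glue {k₁ k₂ : ℕ} {F₁ F₂ : L → List (Fin δ) → L}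
    (h₁ : IsExtension P S k₁ F₁) (h₂ : IsExtension P S k₂ F₂) :
    IsExtension P S (k₁ + k₂) (TreeLCL.glue k₁ F₁ F₂) where
  nil a ha := by
    unfold TreeLCL.glue
    split_ifs with h
    · exact h₁.nil a ha
    · have : F₁ a [] = a := h₁.nil a ha
      simp [this, h₂.nil a ha]
  allows a ha l hl := by
    have hmem : k₁ ≤ l.length → F₁ a (l.drop (l.length - k₁)) ∈ S := fun h =>
      h₁.leaf_mem a ha _ (by simp; omega)
    -- The children of the node lie above the seam, on it, or below it. On the seam the two families
    -- agree because `F₂` returns its root label at `[]`.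
    rcases lt_trichotomy (l.length + 1) k₁ with h | h | h
    · have h' : l.length < k₁ := by omega
      simpa [TreeLCL.glue, h, h'] using h₁.allows a ha l h'
    · have h' : l.length < k₁ := by omega
      have key := h₁.allows a ha l h'
      have e : ∀ i, F₂ (F₁ a (i :: l)) [] = F₁ a (i :: l) := fun i =>
        h₂.nil _ (h₁.leaf_mem a ha _ (by simpa using h))
      simpa [TreeLCL.glue, h, h', e] using key
    · have h' : ¬ l.length < k₁ := by omega
      have h'' : ¬ l.length + 1 < k₁ := by omega
      have e : l.length + 1 - k₁ = l.length - k₁ + 1 := by omega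
      simpa [TreeLCL.glue, h', h'', e] using
        h₂.allows _ (hmem (by omega)) (l.take (l.length - k₁)) (by simp; omega)
  leaf_mem a ha l hl := by
    have h' : ¬ l.length < k₁ := by omega
    simp only [TreeLCL.glue, h', if_false]
    exact h₂.leaf_mem _ (h₁.leaf_mem a ha _ (by simp; omega)) _ (by simp; omega)

/-- Only the upper family has to be a block: the labels on the seam no longer depend on the root
label, and everything below is a function of them. -/
theorem IsBlock.glue {k₁ k₂ : ℕ} {F₁ F₂ : L → List (Fin δ) → L}
    (h₁ : IsBlock P S k₁ F₁) (h₂ : IsExtension P S k₂ F₂) :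
    IsBlock P S (k₁ + k₂) (TreeLCL.glue k₁ F₁ F₂) where
  toIsExtension := h₁.toIsExtension.glue h₂
  leaf_eq a ha b hb l hl := by
    have h' : ¬ l.length < k₁ := by omega
    simp only [TreeLCL.glue, h', if_false]
    rw [h₁.leaf_eq a ha b hb _ (by simp; omega)]

/-! ### Blocks from the trees of a certificate -/

namespace LabeledTree

/-- The label of the node that is reached from the root by the path `l`. -/
def labelAt : {d : ℕ} → LabeledTree δ L d → List (Fin δ) → L
  | _, T, [] => T.rootLabel
  | _, leaf a, _ :: _ => a
  | _, node _ c, i :: l => (c i).labelAt l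

theorem LeafLabelsIn.labelAt_mem {d : ℕ} {T : LabeledTree δ L d} (h : T.LeafLabelsIn S)
    {l : List (Fin δ)} (hl : l.length = d) : T.labelAt l ∈ S := by
  induction T generalizing l with
  | leaf a =>
    obtain rfl := List.length_eq_zero_iff.mp hl
    simpa [labelAt, rootLabel, LeafLabelsIn] using h
  | node a c ih =>
    cases l with
    | nil => simp at hl
    | cons i l => exact ih i (h i) (by simpa using hl)

theorem LabelsIn.rootLabel_mem {d : ℕ} {T : LabeledTree δ L d} (h : T.LabelsIn S) :
    T.rootLabel ∈ S := by
  cases T with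
  | leaf a => exact h
  | node a c => exact h.1

theorem LabelsIn.leafLabelsIn {d : ℕ} {T : LabeledTree δ L d} (h : T.LabelsIn S) :
    T.LeafLabelsIn S := by
  induction T with
  | leaf a => exact h
  | node a c ih => exact fun i => ih i (h.2 i)

/-- A correctly labeled tree can be rearranged along an isomorphism that preserves leaf labels. -/
theorem LeafIso.exists_labeling {d : ℕ} {T T' : LabeledTree δ L d} (h : T.LeafIso T')
    (hc : T'.Correct P) : ∃ G : List (Fin δ) → L, G [] = T'.rootLabel ∧
      (∀ l, l.length < d → P.Allows (G l) (fun i => G (l ++ [i]))) ∧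
      ∀ l, l.length = d → G l = T.labelAt l := by
  induction T with
  | leaf a =>
    cases T' with
    | leaf a' =>
      refine ⟨fun _ => a', rfl, by simp, fun l hl => ?_⟩
      obtain rfl := List.length_eq_zero_iff.mp hl
      exact (h : a = a').symm
  | node a c ih =>
    cases T' with
    | node a' c' =>
      obtain ⟨ρ, hρ⟩ := h
      choose G hG using fun i => ih i (hρ i) (hc.2 (ρ i))
      refine ⟨fun l => match l with
        | [] => a'
        | i :: l => G i l, rfl, ?_, ?_⟩
      · rintro (_ | ⟨i, l⟩) hl
        · simpa [(hG _).1] using hc.1.comp_perm ρ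
        · exact (hG i).2.1 l (by simpa using hl)
      · rintro (_ | ⟨i, l⟩) hl
        · simp at hl
        · exact (hG i).2.2 l (by simpa using hl)

/-- Trees with isomorphic leaf labelings, whose leaf labels are among their root labels,
form a block. -/
theorem exists_isBlock {t d : ℕ} {σ : Fin (t + 1) → L} (T : Fin (t + 1) → LabeledTree δ L d)
    (leaves : ∀ i, (T i).LeafLabelsIn (Set.range σ)) (correct : ∀ i, (T i).Correct P)
    (iso : ∀ i j, (T i).LeafIso (T j)) (root : ∀ i, (T i).rootLabel = σ i) :
    ∃ F, IsBlock P (Set.range σ) d F := by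
  classical
  choose G hG using fun i => (iso 0 i).exists_labeling (correct i)
  -- All trees are rearranged to the leaf labeling of `T 0`. Since `σ` need not be injective, one
  -- index is chosen per label. The path is reversed because `G` reads it from the root and blocks
  -- read it from the node.
  let F : L → List (Fin δ) → L := fun a l =>
    if h : a ∈ Set.range σ then G h.choose l.reverse else a
  have hF : ∀ a ∈ Set.range σ, ∃ i, σ i = a ∧ ∀ l, F a l = G i l.reverse := fun a ha =>
    ⟨ha.choose, ha.choose_spec, fun l => by simp only [F, ha, dite_true]⟩
  have hleaf : ∀ a ∈ Set.range σ, ∀ l : List (Fin δ), l.length = d →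
      F a l = (T 0).labelAt l.reverse := by
    intro a ha l hl
    obtain ⟨i, -, hi⟩ := hF a ha
    rw [hi, (hG i).2.2 _ (by simpa using hl)]
  refine ⟨F, ⟨⟨?_, ?_, ?_⟩, ?_⟩⟩
  · intro a ha
    obtain ⟨i, rfl, hi⟩ := hF a ha
    rw [hi, List.reverse_nil, (hG i).1, root]
  · intro a ha l hl
    obtain ⟨i, -, hi⟩ := hF a ha
    simpa [hi] using (hG i).2.1 l.reverse (by simpa using hl)
  · intro a ha l hl
    rw [hleaf a ha l hl]
    exact (leaves 0).labelAt_mem (by simpa using hl)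
  · intro a ha b hb l hl
    rw [hleaf a ha l hl, hleaf b hb l hl]

end LabeledTree

/-- One level of a uniform certificate is an extension. -/
theorem UniformCertificate.exists_isExtension_one (C : UniformCertificate P) :
    ∃ F, IsExtension P (Set.range C.σ) 1 F := by
  classical
  have step : ∀ a ∈ Set.range C.σ, ∃ b : Fin δ → L, P.Allows a b ∧ ∀ i, b i ∈ Set.range C.σ := by
    rintro _ ⟨i, rfl⟩
    obtain ⟨t, σ, d, hd, T, labels, correct, iso, root⟩ := C
    obtain ⟨d, rfl⟩ : ∃ e, d = e + 1 := ⟨d - 1, by omega⟩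
    have hl := labels i
    have hc := correct i
    have hr := root i
    cases hT : T i with
    | node a c =>
      rw [hT] at hl hc hr
      obtain rfl : a = σ i := hr
      exact ⟨_, hc.1, fun j => (hl.2 j).rootLabel_mem⟩
  choose b hb using step
  refine ⟨fun a l => match l with
    | [] => a
    | i :: _ => if h : a ∈ Set.range C.σ then b a h i else a, fun _ _ => rfl, ?_, ?_⟩
  · intro a ha l hl
    obtain rfl := List.length_eq_zero_iff.mp (Nat.lt_one_iff.mp hl)
    simpa only [ha, dite_true] using (hb a ha).1
  · intro a ha l hl
    obtain ⟨i, rfl⟩ := List.length_eq_one_iff.mp hl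
    simpa only [ha, dite_true] using (hb a ha).2 i

theorem UniformCertificate.exists_isBlock (C : UniformCertificate P) (k : ℕ) (hk : C.d ≤ k) :
    ∃ F, IsBlock P (Set.range C.σ) k F := by
  obtain ⟨E, hE⟩ := C.exists_isExtension_one
  induction k, hk using Nat.le_induction with
  | base =>
    exact LabeledTree.exists_isBlock C.tree (fun i => (C.labels i).leafLabelsIn) C.correct C.iso
      C.root
  | succ k _ ih =>
    obtain ⟨F, hF⟩ := ih
    exact ⟨_, hF.glue hE⟩

theorem exists_isBlock_mul {d : ℕ} (h : ∃ F, IsBlock P S d F) (m : ℕ) (hm : 0 < m) :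
    ∃ F, IsBlock P S (m * d) F := by
  obtain ⟨F, hF⟩ := h
  induction m, hm using Nat.le_induction with
  | base => exact ⟨F, by simpa using hF⟩
  | succ m _ ih =>
    obtain ⟨F', hF'⟩ := ih
    exact ⟨_, by simpa [add_mul] using hF'.glue hF.toIsExtension⟩

/-- Internal labels may leave `S`, so only whole trees can be stacked; coprimality makes all depths
from the Frobenius bound on reachable. -/
theorem CoprimeCertificate.exists_isBlock (C : CoprimeCertificate P) (k : ℕ)
    (hk : 2 * (C.d₁ * C.d₂) ≤ k) : ∃ F, IsBlock P (Set.range C.σ) k F := by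
  have h₁ := LabeledTree.exists_isBlock C.tree₁ C.leaves₁ C.correct₁ C.iso₁ C.root₁
  have h₂ := LabeledTree.exists_isBlock C.tree₂ C.leaves₂ C.correct₂ C.iso₂ C.root₂
  obtain ⟨x, y, rfl⟩ := Nat.exists_add_mul_eq_of_gcd_dvd_of_mul_pred_le C.d₁ C.d₂ k
    (by simp [C.coprime.gcd_eq_one])
    ((Nat.mul_le_mul (Nat.pred_le _) (Nat.pred_le _)).trans (by omega))
  -- A zero coefficient is treated separately, since a family of depth `0` is in general not a
  -- block.
  rcases Nat.eq_zero_or_pos x with rfl | hx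
  · have : 0 < C.d₁ * C.d₂ := Nat.mul_pos C.one_le_d₁ C.one_le_d₂
    have hy : 0 < y := Nat.pos_of_ne_zero (by rintro rfl; omega)
    simpa using exists_isBlock_mul h₂ y hy
  · obtain ⟨F₁, hF₁⟩ := exists_isBlock_mul h₁ x hx
    rcases Nat.eq_zero_or_pos y with rfl | hy
    · exact ⟨F₁, by simpa using hF₁⟩
    · obtain ⟨F₂, hF₂⟩ := exists_isBlock_mul h₂ y hy
      exact ⟨_, hF₁.glue hF₂.toIsExtension⟩

end Blocks

/-! ### Symmetry breaking on sequences -/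

/-- A number that encodes a position at which the binary expansions of `a` and `b` differ,
together with the digit of `a` at this position. -/
noncomputable def bitColor (a b : ℕ) : ℕ :=
  open Classical in
  if h : ∃ i, a.testBit i ≠ b.testBit i then 2 * Nat.find h + (a.testBit (Nat.find h)).toNat else 0

/-- Equal values would give the same position for both pairs and the same digit of `a` and `b`
there, although this position was chosen because the digits differ (Cole–Vishkin). -/
theorem bitColor_ne {a b c : ℕ} (hab : a ≠ b) (hbc : b ≠ c) : bitColor a b ≠ bitColor b c := by
  classical
  have h₁ := Nat.exists_testBit_ne_of_ne hab
  have h₂ := Nat.exists_testBit_ne_of_ne hbc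
  have s₁ := Nat.find_spec h₁
  intro h
  simp only [bitColor, h₁, h₂, dite_true] at h
  have b₁ := Bool.toNat_lt (a.testBit (Nat.find h₁))
  have b₂ := Bool.toNat_lt (b.testBit (Nat.find h₂))
  have e : Nat.find h₁ = Nat.find h₂ := by omega
  rw [e] at h s₁
  have key : ∀ x y : Bool, x.toNat = y.toNat → x = y := by decide
  exact s₁ (key _ _ (by omega))

theorem bitColor_le {a b y : ℕ} (ha : a ≤ y) (hb : b ≤ y) :
    bitColor a b ≤ 2 * Nat.log 2 y + 1 := by
  classical
  unfold bitColor
  split_ifs with h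
  · have hlt : ∀ c ≤ y, ∀ i, Nat.log 2 y < i → c.testBit i = false := fun c hc i hi =>
      Nat.testBit_lt_two_pow (hc.trans_lt (Nat.lt_pow_of_log_lt one_lt_two hi))
    have : Nat.find h ≤ Nat.log 2 y := by
      by_contra! hi
      exact Nat.find_spec h (by rw [hlt a ha _ hi, hlt b hb _ hi])
    have := Bool.toNat_lt (a.testBit (Nat.find h))
    omega
  · omega

/-- One step of color reduction, along pairs of positions at distance `r`. -/
noncomputable def reduceStep (r : ℕ) (a : ℕ → ℕ) (i : ℕ) : ℕ := bitColor (a i) (a (i + r))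

theorem reduceStep_iterate_ne {r : ℕ} {a : ℕ → ℕ} (h : ∀ i, a i ≠ a (i + r)) (t i : ℕ) :
    (reduceStep r)^[t] a i ≠ (reduceStep r)^[t] a (i + r) := by
  induction t generalizing i with
  | zero => exact h i
  | succ t ih =>
    simp only [Function.iterate_succ_apply']
    exact bitColor_ne (ih i) (ih (i + r))

theorem reduceStep_iterate_le {r N : ℕ} {a : ℕ → ℕ} (h : ∀ i, a i ≤ N) (t i : ℕ) :
    (reduceStep r)^[t] a i ≤ (fun y => 2 * Nat.log 2 y + 1)^[t] N := by
  induction t generalizing i with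
  | zero => exact h i
  | succ t ih =>
    simp only [Function.iterate_succ_apply']
    exact bitColor_le (ih i) (ih (i + r))

theorem reduceStep_iterate_shift {r : ℕ} {a b : ℕ → ℕ} (h : ∀ i, b (i + 1) = a i) (t i : ℕ) :
    (reduceStep r)^[t] b (i + 1) = (reduceStep r)^[t] a i := by
  induction t generalizing i with
  | zero => exact h i
  | succ t ih =>
    simp only [Function.iterate_succ_apply', reduceStep]
    rw [ih, add_right_comm, ih]

theorem reduceStep_iterate_congr {r n t : ℕ} {a b : ℕ → ℕ} (h : ∀ i < n + r * t, a i = b i)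
    {i : ℕ} (hi : i < n) : (reduceStep r)^[t] a i = (reduceStep r)^[t] b i := by
  induction t generalizing i n with
  | zero => exact h i (by simpa using hi)
  | succ t ih =>
    simp only [Function.iterate_succ_apply', reduceStep]
    have h' : ∀ i < (n + r) + r * t, a i = b i := fun i hi => h i (by rw [mul_add]; omega)
    rw [ih h' (by omega), ih h' (by omega)]

/-- The number of colors used by `distColor`. -/
def numColors (K Q : ℕ) : ℕ := Fintype.card (Fin K → Fin (Q + 1))

/-- The color after `t` reduction steps, combined over all distances `1, …, K`. -/
noncomputable def distColor (K Q t : ℕ) (a : ℕ → ℕ) (i : ℕ) : ℕ :=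
  Fintype.equivFin (Fin K → Fin (Q + 1))
    -- Reduction modulo `Q + 1` changes nothing once the values are at most `Q`; it keeps the number
    -- of colors bounded without any hypothesis.
    (fun r => Fin.ofNat (Q + 1) ((reduceStep (r + 1))^[t] a i))

theorem distColor_lt (K Q t : ℕ) (a : ℕ → ℕ) (i : ℕ) : distColor K Q t a i < numColors K Q :=
  Fin.isLt _

theorem distColor_ne {K Q t N : ℕ} {a : ℕ → ℕ} (hN : ∀ i, a i ≤ N)
    (hQ : (fun y => 2 * Nat.log 2 y + 1)^[t] N ≤ Q)
    (ha : ∀ i j, i < j → j < i + K → a i ≠ a j) {i j : ℕ} (hij : i < j) (hj : j < i + K) :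
    distColor K Q t a i ≠ distColor K Q t a j := by
  intro h
  have h := (Fintype.equivFin (Fin K → Fin (Q + 1))).injective (Fin.ext h)
  obtain ⟨r, rfl⟩ : ∃ r, j = i + (r + 1) := ⟨j - i - 1, by omega⟩
  have h := congrArg Fin.val (congrFun h ⟨r, by omega⟩)
  have hle : ∀ i, (reduceStep (r + 1))^[t] a i < Q + 1 := fun i =>
    Nat.lt_succ_of_le ((reduceStep_iterate_le hN t i).trans hQ)
  simp only [Fin.val_ofNat, Nat.mod_eq_of_lt (hle _)] at h
  exact reduceStep_iterate_ne (fun i => ha i (i + (r + 1)) (by omega) (by omega)) t i h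

theorem distColor_shift {K Q t : ℕ} {a b : ℕ → ℕ} (h : ∀ i, b (i + 1) = a i) (i : ℕ) :
    distColor K Q t b (i + 1) = distColor K Q t a i := by
  simp only [distColor, reduceStep_iterate_shift h]

theorem distColor_congr {K Q t n : ℕ} {a b : ℕ → ℕ} (h : ∀ i < n + K * t, a i = b i)
    {i : ℕ} (hi : i < n) : distColor K Q t a i = distColor K Q t b i := by
  have : ∀ r : Fin K, (reduceStep (r + 1))^[t] a i = (reduceStep (r + 1))^[t] b i := fun r =>
    reduceStep_iterate_congr (fun j hj => h j (hj.trans_le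
      (Nat.add_le_add_left (Nat.mul_le_mul_right t r.isLt) n))) hi
  simp only [distColor, this]

/-! ### Greedy selection along a sequence -/

/-- The set selected greedily in the order of the colors `c`, under the condition that selected
positions have distance at least `K`. -/
def Greedy (K : ℕ) (c : ℕ → ℕ) (i : ℕ) : Prop :=
  ∀ j, (j < i + K ∧ i < j + K ∧ c j < c i) → ¬ Greedy K c j
termination_by c i
decreasing_by rename_i h; exact h.2.2

theorem greedy_iff {K : ℕ} {c : ℕ → ℕ} {i : ℕ} :
    Greedy K c i ↔ ∀ j, (j < i + K ∧ i < j + K ∧ c j < c i) → ¬ Greedy K c j := by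
  rw [Greedy]

/-- Of two positions that are too close, the one with the smaller color would exclude the other. -/
theorem Greedy.add_le {K : ℕ} {c : ℕ → ℕ} (hc : ∀ i j, i < j → j < i + K → c i ≠ c j)
    {i j : ℕ} (hi : Greedy K c i) (hj : Greedy K c j) (hij : i < j) : i + K ≤ j := by
  by_contra! h
  rcases (hc i j hij h).lt_or_gt with h' | h'
  · exact greedy_iff.mp hj i ⟨by omega, h, h'⟩ hi
  · exact greedy_iff.mp hi j ⟨h, by omega, h'⟩ hj

theorem exists_greedy {K : ℕ} (hK : 0 < K) (c : ℕ → ℕ) (i : ℕ) :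
    ∃ j, j < i + K ∧ i < j + K ∧ Greedy K c j := by
  by_cases h : Greedy K c i
  · exact ⟨i, by omega, by omega, h⟩
  · rw [greedy_iff] at h
    push Not at h
    obtain ⟨j, ⟨h₁, h₂, -⟩, h₃⟩ := h
    exact ⟨j, h₁, h₂, h₃⟩

/-- A decision is traced through positions of strictly decreasing color, each less than `K` away
from the last. It therefore reaches back by at most `K * c i` and never sees the additional first
entry of `c'`. -/
theorem greedy_shift {K : ℕ} {c c' : ℕ → ℕ} (h : ∀ i, c' (i + 1) = c i) {i : ℕ}
    (hi : K * c i ≤ i) : Greedy K c' (i + 1) ↔ Greedy K c i := by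
  induction hn : c i using Nat.strong_induction_on generalizing i with
  | _ n ih =>
    subst hn
    have hstep : ∀ j, j < i + K → i < j + K → c j < c i →
        (Greedy K c' (j + 1) ↔ Greedy K c j) := fun j h₁ h₂ h₃ =>
      ih (c j) h₃ (by nlinarith) rfl
    rw [greedy_iff, greedy_iff (c := c)]
    constructor
    · rintro H j ⟨h₁, h₂, h₃⟩
      rw [← hstep j h₁ h₂ h₃]
      exact H (j + 1) ⟨by omega, by omega, by rwa [h, h]⟩
    · rintro H (_ | j) ⟨h₁, h₂, h₃⟩
      -- Position `0` of `c'` has no counterpart in `c`. It is out of reach: here `c i` is positive,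
      -- hence `K ≤ i`.
      · rw [h] at h₃
        have : K * 1 ≤ K * c i := Nat.mul_le_mul_left K (by omega)
        omega
      · rw [h, h] at h₃
        rw [hstep j (by omega) (by omega) h₃]
        exact H j ⟨by omega, by omega, h₃⟩

theorem greedy_congr {K n : ℕ} {c c' : ℕ → ℕ} (h : ∀ i < n, c i = c' i) {i : ℕ}
    (hi : i + K * c i < n) : Greedy K c i ↔ Greedy K c' i := by
  induction hn : c i using Nat.strong_induction_on generalizing i with
  | _ m ih =>
    subst hn
    have hin : i < n := by omega
    have hlt : ∀ j, j < i + K → c j < c i ∨ c' j < c i → j < n := by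
      intro j h₁ h₂
      have : 0 < c i := by omega
      have : K * 1 ≤ K * c i := Nat.mul_le_mul_left K this
      omega
    have hstep : ∀ j, j < i + K → c j < c i → (Greedy K c j ↔ Greedy K c' j) :=
      fun j h₁ h₂ => ih (c j) h₂ (by nlinarith) rfl
    rw [greedy_iff, greedy_iff (c := c')]
    refine forall_congr' fun j => ?_
    constructor
    · rintro H ⟨h₁, h₂, h₃⟩
      rw [← h i hin] at h₃
      rw [← h j (hlt j h₁ (.inr h₃))] at h₃
      rw [← hstep j h₁ h₃]
      exact H ⟨h₁, h₂, h₃⟩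
    · rintro H ⟨h₁, h₂, h₃⟩
      rw [hstep j h₁ h₃]
      rw [h j (hlt j h₁ (.inl h₃)), h i hin] at h₃
      exact H ⟨h₁, h₂, h₃⟩

/-! ### Labels from a selected set of positions -/

/-- The first position in `m` that is at least `p`. -/
noncomputable def nextPos (m : ℕ → Prop) (p : ℕ) : ℕ := sInf {q | p ≤ q ∧ m q}

/-- The last position in `m` that is less than `p`. -/
noncomputable def prevPos (m : ℕ → Prop) (p : ℕ) : ℕ := sSup {q | q < p ∧ m q}

theorem nextPos_eq {m : ℕ → Prop} {p q : ℕ} (hpq : p ≤ q) (hq : m q)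
    (h : ∀ r, p ≤ r → r < q → ¬ m r) : nextPos m p = q := by
  have hl : IsLeast {q | p ≤ q ∧ m q} q :=
    ⟨⟨hpq, hq⟩, fun r hr => by by_contra! hlt; exact h r hr.1 hlt hr.2⟩
  exact hl.csInf_eq

theorem prevPos_eq {m : ℕ → Prop} {p q : ℕ} (hqp : q < p) (hq : m q)
    (h : ∀ r, q < r → r < p → ¬ m r) : prevPos m p = q := by
  have hl : IsGreatest {q | q < p ∧ m q} q :=
    ⟨⟨hqp, hq⟩, fun r hr => by by_contra! hlt; exact h r hlt hr.1 hr.2⟩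
  exact hl.csSup_eq

theorem nextPos_spec {m : ℕ → Prop} {p q : ℕ} (hpq : p ≤ q) (hq : m q) :
    p ≤ nextPos m p ∧ nextPos m p ≤ q ∧ m (nextPos m p) ∧
      ∀ r, p ≤ r → r < nextPos m p → ¬ m r := by
  have h : nextPos m p ∈ {q | p ≤ q ∧ m q} := Nat.sInf_mem ⟨q, hpq, hq⟩
  refine ⟨h.1, Nat.sInf_le ⟨hpq, hq⟩, h.2, fun r h₁ h₂ h₃ => ?_⟩
  exact absurd (Nat.sInf_le (s := {q | p ≤ q ∧ m q}) ⟨h₁, h₃⟩) (not_le.mpr h₂)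

theorem prevPos_spec {m : ℕ → Prop} {p q : ℕ} (hqp : q < p) (hq : m q) :
    prevPos m p < p ∧ q ≤ prevPos m p ∧ m (prevPos m p) ∧
      ∀ r, prevPos m p < r → r < p → ¬ m r := by
  have hb : BddAbove {q | q < p ∧ m q} := ⟨p, fun r hr => hr.1.le⟩
  have h : prevPos m p ∈ {q | q < p ∧ m q} := Nat.sSup_mem ⟨q, hqp, hq⟩ hb
  exact ⟨h.1, le_csSup hb ⟨hqp, hq⟩, h.2, fun r h₁ h₂ h₃ =>
    absurd (le_csSup hb ⟨h₂, h₃⟩) (not_le.mpr h₁)⟩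

section Labels

variable {δ : ℕ} {L : Type}

/-- The entries of `π` at the positions in `[i, j)`. -/
def segment {α : Type} (π : ℕ → α) (i j : ℕ) : List α := (List.range' i (j - i)).map π

@[simp]
theorem length_segment {α : Type} (π : ℕ → α) (i j : ℕ) : (segment π i j).length = j - i := by
  simp [segment]

theorem segment_shift {α : Type} {π π' : ℕ → α} (h : ∀ i, π' (i + 1) = π i) (i j : ℕ) :
    segment π' (i + 1) (j + 1) = segment π i j := by
  apply List.ext_getElem <;> simp [segment, h, add_right_comm]

theorem segment_zero_shift {α : Type} {π π' : ℕ → α} (h : ∀ i, π' (i + 1) = π i) (j : ℕ) :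
    segment π' 0 (j + 1) = π' 0 :: segment π 0 j := by
  rw [← segment_shift h]
  simp [segment, List.range'_succ]

theorem segment_congr {α : Type} {π π' : ℕ → α} {i j n : ℕ} (h : ∀ i < n, π i = π' i)
    (hj : j ≤ n) : segment π i j = segment π' i j := by
  apply List.ext_getElem
  · simp
  · intro a ha _
    simp only [length_segment] at ha
    simpa [segment] using h (i + a) (by omega)

/-- The label of a node, computed from the set `m` of selected positions (on its path towards
the root, shifted by `D`) and from the ports `π` on this path. -/
noncomputable def blockLabel (F : ℕ → L → List (Fin δ) → L) (a : L) (D : ℕ) (m : ℕ → Prop)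
    (π : ℕ → Fin δ) : L :=
  let top := nextPos m D
  let top' := nextPos m (top + 1)
  F (top - prevPos m top) (F (top' - top) a (segment π (top - D) (top' - D)))
    (segment π 0 (top - D))

/-- The node itself sits at position `D` of `m`. Hence `top < 2 * D` and `top' < 3 * D`, while ports
are counted from the node, so only indices below `top' - D < 2 * D` occur. -/
theorem blockLabel_congr {F : ℕ → L → List (Fin δ) → L} {a : L} {D : ℕ} {m m' : ℕ → Prop}
    {π π' : ℕ → Fin δ} (hD : 0 < D) (hm : ∀ p, ∃ q, p ≤ q ∧ q < p + D ∧ m q)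
    (hmm : ∀ p < 3 * D, (m p ↔ m' p)) (hπ : ∀ p < 2 * D, π p = π' p) :
    blockLabel F a D m π = blockLabel F a D m' π' := by
  have next : ∀ p, p + D ≤ 3 * D → nextPos m' p = nextPos m p := by
    intro p hp
    obtain ⟨q, h₁, h₂, h₃⟩ := hm p
    obtain ⟨s₁, s₂, s₃, s₄⟩ := nextPos_spec h₁ h₃
    exact nextPos_eq s₁ ((hmm _ (by omega)).mp s₃) fun r h h' =>
      fun hr => s₄ r h h' ((hmm _ (by omega)).mpr hr)
  obtain ⟨q, h₁, h₂, h₃⟩ := hm D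
  obtain ⟨s₁, s₂, s₃, s₄⟩ := nextPos_spec h₁ h₃
  obtain ⟨q', h₁', h₂', h₃'⟩ := hm (nextPos m D + 1)
  obtain ⟨t₁, t₂, t₃, t₄⟩ := nextPos_spec h₁' h₃'
  obtain ⟨q'', h₁'', h₂'', h₃''⟩ := hm (nextPos m D - D)
  obtain ⟨u₁, u₂, u₃, u₄⟩ := prevPos_spec (p := nextPos m D) (by omega) h₃''
  have prev : prevPos m' (nextPos m D) = prevPos m (nextPos m D) :=
    prevPos_eq u₁ ((hmm _ (by omega)).mp u₃) fun r h h' =>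
      fun hr => u₄ r h h' ((hmm _ (by omega)).mpr hr)
  simp only [blockLabel]
  rw [next D (by omega), next (nextPos m D + 1) (by omega), prev,
    segment_congr hπ (by omega), segment_congr hπ (by omega)]

/-- A child sees the marks of its parent shifted by one. Either both lie in the same block, whose
configurations are allowed, or the children are leaves of the parent's block and roots of the next
ones, where independence of the root label makes the two descriptions agree. The shift by `D` places
`bot` below the node, so the depth of the block is known. -/
theorem blockLabel_allows {P : LCL δ L} {S : Set L} {F : ℕ → L → List (Fin δ) → L} {a : L}
    (ha : a ∈ S) {K D : ℕ} (hD : 0 < D) (hF : ∀ k, K ≤ k → IsBlock P S k (F k))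
    {m : ℕ → Prop} {π : ℕ → Fin δ} {m' : Fin δ → ℕ → Prop} {π' : Fin δ → ℕ → Fin δ}
    (hm : ∀ p, ∃ q, p ≤ q ∧ q < p + D ∧ m q) (hm' : ∀ i p, ∃ q, p ≤ q ∧ q < p + D ∧ m' i q)
    (gap : ∀ p q, m p → m q → p < q → p + K ≤ q)
    (gap' : ∀ i p q, m' i p → m' i q → p < q → p + K ≤ q)
    (hmm : ∀ i p, m' i (p + 1) ↔ m p) (hπ : ∀ i p, π' i (p + 1) = π p) (hπ₀ : ∀ i, π' i 0 = i) :
    P.Allows (blockLabel F a D m π) (fun i => blockLabel F a D (m' i) (π' i)) := by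
  obtain ⟨q, h₁, h₂, h₃⟩ := hm D
  obtain ⟨s₁, s₂, s₃, s₄⟩ := nextPos_spec h₁ h₃
  simp only [blockLabel]
  set top := nextPos m D with htop
  obtain ⟨q', h₁', h₂', h₃'⟩ := hm (top + 1)
  obtain ⟨t₁, t₂, t₃, t₄⟩ := nextPos_spec h₁' h₃'
  set top' := nextPos m (top + 1) with htop'
  obtain ⟨q'', h₁'', h₂'', h₃''⟩ := hm (top - D)
  obtain ⟨u₁, u₂, u₃, u₄⟩ := prevPos_spec (p := top) (by omega) h₃''
  set bot := prevPos m top with hbot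
  have hk := gap _ _ u₃ s₃ u₁
  have hk' := gap _ _ s₃ t₃ (by omega)
  have botlt : bot < D := by
    by_contra! h
    exact s₄ bot h u₁ u₃
  obtain ⟨D', rfl⟩ : ∃ D', D = D' + 1 := ⟨D - 1, by omega⟩
  have hB := hF (top - bot) (by omega)
  have hB' := hF (top' - top) (by omega)
  have hroot : F (top' - top) a (segment π (top - (D' + 1)) (top' - (D' + 1))) ∈ S :=
    hB'.leaf_mem a ha _ (by simp; omega)
  have hall := hB.allows _ hroot (segment π 0 (top - (D' + 1))) (by simp; omega)
  -- The children's own position `D' + 1` corresponds to `D'` in `m`: the case distinction is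
  -- whether the children are marked.
  by_cases hD' : m D'
  · have hbot' : bot = D' := by
      by_contra hne
      exact u₄ D' (by omega) (by omega) hD'
    convert hall using 2 with i
    have e₁ : nextPos (m' i) (D' + 1) = D' + 1 :=
      nextPos_eq le_rfl ((hmm i D').mpr hD') fun r h h' => by omega
    have e₂ : nextPos (m' i) (D' + 1 + 1) = top + 1 := by
      refine nextPos_eq (by omega) ((hmm i _).mpr s₃) ?_
      rintro (_ | r) h h'
      · omega
      · rw [hmm]
        exact s₄ r (by omega) (by omega)
    -- The block below a child matters only through its depth being at least `K`, so that it
    -- reproduces its root label.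
    obtain ⟨b, g₁, g₂, g₃⟩ := hm' i 0
    obtain ⟨v₁, v₂, v₃, -⟩ := prevPos_spec (p := D' + 1) (by omega) g₃
    have hB'' := hF (D' + 1 - prevPos (m' i) (D' + 1)) (by
      have := gap' i _ _ v₃ ((hmm i D').mpr hD') v₁
      omega)
    have hseg : segment (π' i) 0 (top + 1 - (D' + 1)) =
        i :: segment π 0 (top - (D' + 1)) := by
      rw [show top + 1 - (D' + 1) = top - (D' + 1) + 1 by omega, segment_zero_shift (hπ i), hπ₀]
    have hlen : (i :: segment π 0 (top - (D' + 1))).length = top - bot := by simp; omega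
    rw [e₁, e₂, Nat.sub_self, hseg, show top + 1 - (D' + 1) = top - bot by omega]
    rw [show segment (π' i) 0 0 = [] from rfl, hB''.nil _ (hB.leaf_mem a ha _ hlen)]
    exact hB.leaf_eq a ha _ hroot _ hlen
  · convert hall using 2 with i
    have hne : top ≠ D' := by omega
    have e₁ : nextPos (m' i) (D' + 1) = top + 1 := by
      refine nextPos_eq (by omega) ((hmm i _).mpr s₃) ?_
      rintro (_ | r) h h'
      · omega
      · rw [hmm]
        rcases (show D' = r ∨ D' + 1 ≤ r by omega) with rfl | hr
        · exact hD'
        · exact s₄ r hr (by omega)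
    have e₂ : nextPos (m' i) (top + 1 + 1) = top' + 1 := by
      refine nextPos_eq (by omega) ((hmm i _).mpr t₃) ?_
      rintro (_ | r) h h'
      · omega
      · rw [hmm]
        exact t₄ r (by omega) (by omega)
    have e₃ : prevPos (m' i) (top + 1) = bot + 1 := by
      refine prevPos_eq (by omega) ((hmm i _).mpr u₃) ?_
      rintro (_ | r) h h'
      · omega
      · rw [hmm]
        exact u₄ r (by omega) (by omega)
    rw [e₁, e₂, e₃, show top + 1 - (D' + 1) = top - (D' + 1) + 1 by omega,
      show top' + 1 - (D' + 1) = top' - (D' + 1) + 1 by omega, segment_zero_shift (hπ i),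
      segment_shift (hπ i), hπ₀, Nat.add_sub_add_right, Nat.add_sub_add_right]

/-- The positions selected from the sequence `a` of identifiers. -/
def Selected (K Q t : ℕ) (a : ℕ → ℕ) (p : ℕ) : Prop :=
  Greedy K (distColor K Q t a) (p + K * numColors K Q)

theorem exists_selected {K : ℕ} (hK : 0 < K) (Q t : ℕ) (a : ℕ → ℕ) (p : ℕ) :
    ∃ q, p ≤ q ∧ q < p + 2 * K ∧ Selected K Q t a q := by
  -- Centering at distance `K` above `p` turns the two-sided window of `exists_greedy` into one that
  -- starts at `p`.
  obtain ⟨j, h₁, h₂, h₃⟩ := exists_greedy hK (distColor K Q t a) (p + K * numColors K Q + K)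
  obtain ⟨q, rfl⟩ : ∃ q, j = q + K * numColors K Q := ⟨j - K * numColors K Q, by omega⟩
  exact ⟨q, by omega, by omega, h₃⟩

theorem Selected.add_le {K Q t N : ℕ} {a : ℕ → ℕ} (hN : ∀ i, a i ≤ N)
    (hQ : (fun y => 2 * Nat.log 2 y + 1)^[t] N ≤ Q)
    (ha : ∀ i j, i < j → j < i + K → a i ≠ a j) (p q : ℕ) (hp : Selected K Q t a p)
    (hq : Selected K Q t a q) (hpq : p < q) : p + K ≤ q := by
  have := Greedy.add_le (fun i j => distColor_ne hN hQ ha) hp hq (by omega)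
  omega

/-- The offset `K * numColors K Q` in `Selected` is at least the backward reach of any greedy
decision, as colors are below `numColors K Q`. -/
theorem selected_shift {K Q t : ℕ} {a b : ℕ → ℕ} (h : ∀ i, b (i + 1) = a i) (p : ℕ) :
    Selected K Q t b (p + 1) ↔ Selected K Q t a p := by
  unfold Selected
  rw [add_right_comm]
  refine greedy_shift (distColor_shift h) ?_
  exact (Nat.mul_le_mul_left K (distColor_lt K Q t a _).le).trans (Nat.le_add_left _ _)

/-- One `K * numColors K Q` is the offset in `Selected` and the other the forward reach of the
greedy choice; `K * t` accounts for `t` reduction steps, each looking at most `K` ahead. -/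
theorem selected_congr {K Q t n : ℕ} {a b : ℕ → ℕ}
    (h : ∀ i < n + 2 * (K * numColors K Q) + K * t, a i = b i) {p : ℕ} (hp : p < n) :
    Selected K Q t a p ↔ Selected K Q t b p := by
  refine greedy_congr (n := n + 2 * (K * numColors K Q)) (fun i hi => distColor_congr h hi) ?_
  have := Nat.mul_le_mul_left K
    (distColor_lt K Q t a (p + K * numColors K Q)).le
  omega

/-- The label of a node, computed from the identifiers and the ports on its path towards
the root. -/
noncomputable def pathLabel (F : ℕ → L → List (Fin δ) → L) (a : L) (K Q t : ℕ)
    (x : ℕ → ℕ × Fin δ) : L :=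
  blockLabel F a (2 * K) (Selected K Q t fun i => (x i).1) fun i => (x i).2

/-- The number of entries of the path on which `pathLabel` depends. -/
def pathLength (K Q t : ℕ) : ℕ := 3 * (2 * K) + 2 * (K * numColors K Q) + K * t

theorem pathLabel_congr {F : ℕ → L → List (Fin δ) → L} {a : L} {K Q t : ℕ} (hK : 0 < K)
    {x y : ℕ → ℕ × Fin δ} (h : ∀ i < pathLength K Q t, x i = y i) :
    pathLabel F a K Q t x = pathLabel F a K Q t y := by
  refine blockLabel_congr (by omega) (exists_selected hK Q t _) (fun p hp => ?_) fun p hp => ?_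
  · exact selected_congr (fun i hi => by rw [h i hi]) hp
  · rw [h p (by unfold pathLength; omega)]

theorem pathLabel_allows {P : LCL δ L} {S : Set L} {F : ℕ → L → List (Fin δ) → L} {a : L}
    (ha : a ∈ S) {K Q t N : ℕ} (hK : 0 < K) (hF : ∀ k, K ≤ k → IsBlock P S k (F k))
    (hQ : (fun y => 2 * Nat.log 2 y + 1)^[t] N ≤ Q)
    {x : ℕ → ℕ × Fin δ} {y : Fin δ → ℕ → ℕ × Fin δ}
    (hx : ∀ i, (x i).1 ≤ N) (hy : ∀ i j, (y i j).1 ≤ N)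
    (hx' : ∀ i j, i < j → j < i + K → (x i).1 ≠ (x j).1)
    (hy' : ∀ k i j, i < j → j < i + K → (y k i).1 ≠ (y k j).1)
    (hxy : ∀ i j, y i (j + 1) = x j) (hy₀ : ∀ i, (y i 0).2 = i) :
    P.Allows (pathLabel F a K Q t x) (fun i => pathLabel F a K Q t (y i)) :=
  blockLabel_allows ha (by omega) hF (exists_selected hK Q t _)
    (fun _ => exists_selected hK Q t _) (Selected.add_le hx hQ hx')
    (fun i => Selected.add_le (hy i) hQ (hy' i)) (fun i => selected_shift fun j => by rw [hxy])
    (fun i j => by rw [hxy]) hy₀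

end Labels

/-! ### Iterated logarithms -/

theorem log_eval_le (p : Polynomial ℕ) : ∃ A : ℕ, ∀ n : ℕ, 2 ≤ n →
    (Nat.log 2 (p.eval n) : ℝ) ≤ A * Real.logb 2 n := by
  -- `p.eval 1` is the sum of the coefficients; the added `1` keeps the factor positive when `p =
  -- 0`.
  have hle : ∀ n : ℕ, 1 ≤ n → p.eval n ≤ (p.eval 1 + 1) * n ^ p.natDegree := by
    intro n hn
    refine le_trans ?_ (Nat.mul_le_mul_right _ (Nat.le_succ _))
    rw [Polynomial.eval_eq_sum_range, Polynomial.eval_eq_sum_range, Finset.sum_mul]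
    refine Finset.sum_le_sum fun i hi => ?_
    rw [one_pow, mul_one]
    exact Nat.mul_le_mul_left _ (Nat.pow_le_pow_right hn (by simp at hi; omega))
  obtain ⟨C, hC⟩ := exists_nat_ge (Real.logb 2 (p.eval 1 + 1 : ℕ))
  refine ⟨C + p.natDegree, fun n hn => ?_⟩
  have hn' : (0 : ℝ) < n := by positivity
  have h1 : 1 ≤ Real.logb 2 n := by
    rw [Real.le_logb_iff_rpow_le one_lt_two hn', Real.rpow_one]
    exact_mod_cast hn
  calc (Nat.log 2 (p.eval n) : ℝ)
      ≤ Nat.log 2 ((p.eval 1 + 1) * n ^ p.natDegree) := by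
        exact_mod_cast Nat.log_mono_right (hle n (by omega))
    _ ≤ Real.logb 2 ((p.eval 1 + 1) * n ^ p.natDegree : ℕ) := by
        exact_mod_cast Real.natLog_le_logb _ 2
    _ = Real.logb 2 (p.eval 1 + 1 : ℕ) + p.natDegree * Real.logb 2 n := by
        rw [Nat.cast_mul, Real.logb_mul (by positivity) (by positivity), Nat.cast_pow,
          Real.logb_pow]
    _ ≤ C * Real.logb 2 n + p.natDegree * Real.logb 2 n := by
        have : (0 : ℝ) ≤ C := by positivity
        nlinarith
    _ = _ := by push_cast; ring

/-- By Bernoulli's inequality `log₂ x ≤ x - 1` for `x > 2`, so each logarithm lowers an integer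
bound by one. -/
theorem exists_iterate_logb_le_one (x : ℝ) : ∃ k : ℕ, (Real.logb 2)^[k] x ≤ 1 := by
  obtain ⟨m, hm⟩ := exists_nat_ge x
  induction m generalizing x with
  | zero => exact ⟨0, by simpa using hm.trans (by simp)⟩
  | succ m ih =>
    by_cases h : x ≤ 2
    · rcases le_or_gt x 1 with h1 | h1
      · exact ⟨0, h1⟩
      · refine ⟨1, ?_⟩
        rw [Function.iterate_one, Real.logb_le_iff_le_rpow one_lt_two (by linarith)]
        simpa using h
    · obtain ⟨k, hk⟩ := ih (Real.logb 2 x) (by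
        have h1 : Real.logb 2 x ≤ x - 1 := by
          rw [Real.logb_le_iff_le_rpow one_lt_two (by linarith)]
          have := one_add_mul_self_le_rpow_one_add (s := 1) (by norm_num) (p := x - 1)
            (by linarith)
          norm_num at this
          exact this
        push_cast at hm
        linarith)
      exact ⟨k + 1, hk⟩

theorem iterate_logStar_le_one (n : ℕ) : (Real.logb 2)^[logStar n] n ≤ 1 :=
  Nat.sInf_mem (s := {k : ℕ | (Real.logb 2)^[k] (n : ℝ) ≤ 1}) (exists_iterate_logb_le_one n)

theorem one_le_logStar {n : ℕ} (hn : 2 ≤ n) : 1 ≤ logStar n := by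
  by_contra! h
  have := iterate_logStar_le_one n
  rw [Nat.lt_one_iff.mp h, Function.iterate_zero, id] at this
  have : n ≤ 1 := by exact_mod_cast this
  omega

/-- The invariant that lets the reduced colors follow the iterated logarithm. For `x ≥ A` the
constant is absorbed by `log A ≤ log x`, giving `4 * log x + 1 ≤ A * log x`; for `x ≤ A` the value
`4 * log A + 1` stays below `A ^ 2`. -/
theorem reduce_bound_step {A x : ℝ} (hA : 5 ≤ A) {y : ℕ} (h : (y : ℝ) ≤ max (A * x) (A ^ 2)) :
    ((2 * Nat.log 2 y + 1 : ℕ) : ℝ) ≤ max (A * Real.logb 2 x) (A ^ 2) := by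
  have hlA : Real.logb 2 A ≤ A - 1 := by
    rw [Real.logb_le_iff_le_rpow one_lt_two (by linarith)]
    have := one_add_mul_self_le_rpow_one_add (s := 1) (by norm_num) (p := A - 1) (by linarith)
    norm_num at this
    exact this
  have hlA' : 2 ≤ Real.logb 2 A := by
    rw [Real.le_logb_iff_rpow_le one_lt_two (by linarith)]
    norm_num
    linarith
  have hlog : ((2 * Nat.log 2 y + 1 : ℕ) : ℝ) ≤ 2 * Real.logb 2 y + 1 := by
    push_cast
    have := Real.natLog_le_logb y 2
    push_cast at this
    linarith
  rcases Nat.eq_zero_or_pos y with rfl | hy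
  · refine le_max_of_le_right ?_
    have : 1 ≤ A ^ 2 := by nlinarith
    simpa using this
  have hy : (0 : ℝ) < y := by exact_mod_cast hy
  rcases le_total x A with hx | hx
  · refine le_max_of_le_right (hlog.trans ?_)
    have : (y : ℝ) ≤ A ^ 2 := h.trans (max_le (by nlinarith) le_rfl)
    have : Real.logb 2 y ≤ 2 * Real.logb 2 A := by
      refine (Real.logb_le_logb_of_le one_lt_two hy this).trans_eq ?_
      rw [Real.logb_pow]
      norm_num
    nlinarith
  · refine le_max_of_le_left (hlog.trans ?_)
    have : (y : ℝ) ≤ A * x := h.trans (max_le le_rfl (by nlinarith))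
    have : Real.logb 2 y ≤ Real.logb 2 A + Real.logb 2 x := by
      refine (Real.logb_le_logb_of_le one_lt_two hy this).trans_eq ?_
      rw [Real.logb_mul (by linarith) (by linarith)]
    have : Real.logb 2 A ≤ Real.logb 2 x :=
      Real.logb_le_logb_of_le one_lt_two (by linarith) hx
    nlinarith

/-- After `log* n` steps of color reduction, polynomially many colors have become constantly
many. -/
theorem exists_reduce_bound (p : Polynomial ℕ) : ∃ Q : ℕ, ∀ n,
    (fun y => 2 * Nat.log 2 y + 1)^[logStar n] (p.eval n) ≤ Q := by
  obtain ⟨A₀, hA₀⟩ := log_eval_le p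
  -- `2 * A₀ + 1` bounds the first reduction step, and `5` is what `reduce_bound_step` requires.
  set A : ℕ := 2 * A₀ + 1 + 5 with hA
  have hA5 : (5 : ℝ) ≤ A := by rw [hA]; push_cast; linarith [(Nat.cast_nonneg A₀ : (0 : ℝ) ≤ A₀)]
  have key : ∀ n : ℕ, 2 ≤ n → ∀ t : ℕ,
      (((fun y => 2 * Nat.log 2 y + 1)^[t + 1] (p.eval n) : ℕ) : ℝ) ≤
        max (A * (Real.logb 2)^[t + 1] n) ((A : ℝ) ^ 2) := by
    intro n hn t
    induction t with
    | zero =>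
      refine le_max_of_le_left ?_
      have h1 : 1 ≤ Real.logb 2 n := by
        rw [Real.le_logb_iff_rpow_le one_lt_two (by positivity), Real.rpow_one]
        exact_mod_cast hn
      have := hA₀ n hn
      simp only [zero_add, Function.iterate_one, hA]
      push_cast
      nlinarith
    | succ t ih =>
      rw [Function.iterate_succ_apply' _ (t + 1), Function.iterate_succ_apply' _ (t + 1)]
      exact reduce_bound_step hA5 ih
  -- The last two terms cover `n < 2`, where `logStar n = 0` and no reduction takes place.
  refine ⟨A ^ 2 + p.eval 0 + p.eval 1, fun n => ?_⟩
  rcases Nat.lt_or_ge n 2 with hn | hn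
  · have : logStar n = 0 := by
      refine Nat.le_zero.mp (Nat.sInf_le ?_)
      simp only [Set.mem_ofPred_eq, Function.iterate_zero, id]
      exact_mod_cast (by omega : n ≤ 1)
    rw [this, Function.iterate_zero, id]
    interval_cases n <;> omega
  · obtain ⟨t, ht⟩ : ∃ t, logStar n = t + 1 := ⟨logStar n - 1, by have := one_le_logStar hn; omega⟩
    have h1 := iterate_logStar_le_one n
    have h2 := key n hn t
    rw [ht] at h1 ⊢
    have h3 : (((fun y => 2 * Nat.log 2 y + 1)^[t + 1] (p.eval n) : ℕ) : ℝ) ≤ (A : ℝ) ^ 2 :=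
      h2.trans (max_le (by nlinarith) le_rfl)
    have h4 : (fun y => 2 * Nat.log 2 y + 1)^[t + 1] (p.eval n) ≤ A ^ 2 := by exact_mod_cast h3
    omega

open Asymptotics Filter

theorem isBigO_size_eval (p : Polynomial ℕ) :
    (fun n => ((p.eval n).size : ℝ)) =O[atTop] (fun n : ℕ => Real.log n) := by
  obtain ⟨A, hA⟩ := log_eval_le p
  refine IsBigO.of_bound ((A + 1) / Real.log 2) ?_
  filter_upwards [eventually_ge_atTop 2] with n hn
  have h1 : 1 ≤ Real.logb 2 n := by
    rw [Real.le_logb_iff_rpow_le one_lt_two (by positivity), Real.rpow_one]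
    exact_mod_cast hn
  have h2 : (p.eval n).size ≤ Nat.log 2 (p.eval n) + 1 :=
    Nat.size_le.mpr (Nat.lt_pow_succ_log_self one_lt_two _)
  have h3 : ((p.eval n).size : ℝ) ≤ Nat.log 2 (p.eval n) + 1 := by exact_mod_cast h2
  have h4 : 0 ≤ Real.log n := Real.log_natCast_nonneg n
  rw [Real.norm_of_nonneg (by positivity), Real.norm_of_nonneg h4, div_mul_eq_mul_div,
    mul_div_assoc]
  change _ ≤ _ * Real.logb 2 n
  nlinarith [hA n hn]

theorem isBigO_affine_logStar (C K : ℕ) :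
    (fun n => ((C + K * logStar n : ℕ) : ℝ)) =O[atTop] (fun n : ℕ => (logStar n : ℝ)) := by
  refine IsBigO.of_bound (C + K) ?_
  filter_upwards [eventually_ge_atTop 2] with n hn
  rw [Real.norm_of_nonneg (by positivity), Real.norm_of_nonneg (by positivity)]
  have : (1 : ℝ) ≤ logStar n := by exact_mod_cast one_le_logStar hn
  push_cast
  nlinarith [(Nat.cast_nonneg C : (0 : ℝ) ≤ C)]

/-! ### The algorithm -/

theorem foldr_bit_bits (n : ℕ) : n.bits.foldr Nat.bit 0 = n := by
  induction n using Nat.binaryRec' with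
  | zero => simp
  | bit b n h ih => rw [Nat.bits_append_bit n b h, List.foldr_cons, ih]

section Messages

variable {δ : ℕ}

/-- The bit string for an identifier and a port. -/
def encode (x : ℕ × Fin δ) : List Bool := (x.1 * δ + x.2).bits

def decode (hδ : 0 < δ) (l : List Bool) : ℕ × Fin δ :=
  (l.foldr Nat.bit 0 / δ, ⟨l.foldr Nat.bit 0 % δ, Nat.mod_lt _ hδ⟩)

theorem decode_encode (hδ : 0 < δ) (x : ℕ × Fin δ) : decode hδ (encode x) = x := by
  have h : (x.1 * δ + x.2) / δ = x.1 := by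
    rw [mul_comm, Nat.mul_add_div hδ, Nat.div_eq_of_lt x.2.isLt, add_zero]
  have h' : (x.1 * δ + x.2) % δ = x.2 := by
    rw [mul_comm, Nat.mul_add_mod, Nat.mod_eq_of_lt x.2.isLt]
  ext <;> simp [decode, encode, foldr_bit_bits, h, h']

theorem length_encode_le {x : ℕ × Fin δ} {N : ℕ} (h : x.1 ≤ N) :
    (encode x).length ≤ ((N + 1) * δ).size := by
  rw [encode, Nat.size_eq_bits_len]
  refine Nat.size_le_size ?_
  have := Nat.mul_le_mul_right δ h
  have := x.2.isLt
  rw [add_mul]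
  omega

/-- The entry of the path towards the root that belongs to the `j`-th virtual ancestor of
the root. -/
def virtualEntry (hδ : 0 < δ) (N K j : ℕ) : ℕ × Fin δ := (N + 1 + j % K, ⟨0, hδ⟩)

end Messages

/-! ### Paths of ancestors, real and virtual -/

namespace Network

variable {δ : ℕ} {V : Type} (N : Network δ V)

open Classical in
/-- The entry `j` consists of the identifier of the ancestor `j + 1` of the node and of the port
that this ancestor uses for the edge towards the node. Above the root there are virtual
ancestors. -/
noncomputable def path (hδ : 0 < δ) (M K : ℕ) : ℕ → V → ℕ × Fin δ
  | 0, v => if v = N.tree.root then virtualEntry hδ M K 0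
      else (N.ident (N.tree.parent v), N.port v)
  | j + 1, v => if v = N.tree.root then virtualEntry hδ M K (j + 1)
      else path hδ M K j (N.tree.parent v)

variable {hδ : 0 < δ} {M K : ℕ}

theorem path_root (j : ℕ) : N.path hδ M K j N.tree.root = virtualEntry hδ M K j := by
  cases j <;> simp [path]

theorem path_zero {v : V} (hv : v ≠ N.tree.root) :
    N.path hδ M K 0 v = (N.ident (N.tree.parent v), N.port v) := by
  simp [path, hv]

theorem path_succ {v : V} (hv : v ≠ N.tree.root) (j : ℕ) :
    N.path hδ M K (j + 1) v = N.path hδ M K j (N.tree.parent v) := by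
  simp [path, hv]

theorem path_fst (j : ℕ) (v : V) : M < (N.path hδ M K j v).1 ∨
    ∃ k, (N.path hδ M K j v).1 = N.ident (N.tree.parent^[k + 1] v) := by
  induction j generalizing v with
  | zero =>
    by_cases hv : v = N.tree.root
    · left; rw [hv, path_root]; simp only [virtualEntry]; omega
    · right; exact ⟨0, by rw [path_zero N hv]; rfl⟩
  | succ j ih =>
    by_cases hv : v = N.tree.root
    · left; rw [hv, path_root]; simp only [virtualEntry]; omega
    · rw [path_succ N hv]
      rcases ih (N.tree.parent v) with h | ⟨k, h⟩
      · exact .inl h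
      · exact .inr ⟨k + 1, h⟩

theorem path_fst_le (hM : ∀ v, N.ident v ≤ M) (hK : 0 < K) (j : ℕ) (v : V) :
    (N.path hδ M K j v).1 ≤ M + K := by
  induction j generalizing v with
  | zero =>
    by_cases hv : v = N.tree.root
    · rw [hv, path_root]
      have := Nat.mod_lt 0 hK
      simp only [virtualEntry]; omega
    · rw [path_zero N hv]; exact (hM _).trans (Nat.le_add_right _ _)
  | succ j ih =>
    by_cases hv : v = N.tree.root
    · rw [hv, path_root]
      have := Nat.mod_lt (j + 1) hK
      simp only [virtualEntry]; omega
    · rw [path_succ N hv]; exact ih _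

/-- A repeated identifier would make `v` periodic under `parent`. All orbits end at the fixed root,
so `v` would be the root, whose path consists of virtual identifiers above `M`. -/
theorem ident_ne_path (hM : ∀ v, N.ident v ≤ M) (j : ℕ) (v : V) :
    N.ident v ≠ (N.path hδ M K j v).1 := by
  intro h
  by_cases hv : v = N.tree.root
  · have := hM v
    rw [h, hv, path_root] at this
    simp only [virtualEntry] at this
    omega
  · rcases N.path_fst (hδ := hδ) (M := M) (K := K) j v with h' | ⟨k, h'⟩
    · have := hM v; omega
    · have hper : Function.IsPeriodicPt N.tree.parent (k + 1) v :=
        (N.ident_injective (h.trans h')).symm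
      obtain ⟨s, hs⟩ := N.tree.reaches_root v
      have hroot : ∀ r, N.tree.parent^[r] N.tree.root = N.tree.root := fun r =>
        Function.iterate_fixed N.tree.parent_root r
      have h₁ : N.tree.parent^[(k + 1) * s] v = v := hper.mul_const s
      rw [add_mul, one_mul, Function.iterate_add_apply, hs, hroot] at h₁
      exact hv h₁.symm

/-- Among the virtual ancestors, residues modulo `K` separate positions less than `K` apart; all
other cases reduce to `ident_ne_path`. -/
theorem path_fst_ne (hM : ∀ v, N.ident v ≤ M) (v : V) (i j : ℕ) (hij : i < j) (hj : j < i + K) :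
    (N.path hδ M K i v).1 ≠ (N.path hδ M K j v).1 := by
  induction i generalizing v j with
  | zero =>
    obtain ⟨j, rfl⟩ : ∃ j', j = j' + 1 := ⟨j - 1, by omega⟩
    by_cases hv : v = N.tree.root
    · rw [hv, path_root, path_root]
      simp only [virtualEntry, Nat.zero_mod, Nat.mod_eq_of_lt (show j + 1 < K by omega)]
      omega
    · rw [path_zero N hv, path_succ N hv]
      exact N.ident_ne_path hM j _
  | succ i ih =>
    obtain ⟨j, rfl⟩ : ∃ j', j = j' + 1 := ⟨j - 1, by omega⟩
    by_cases hv : v = N.tree.root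
    · rw [hv, path_root, path_root]
      simp only [virtualEntry]
      intro h
      have h' : i + 1 ≡ j + 1 [MOD K] := by unfold Nat.ModEq; omega
      have := (Nat.modEq_iff_dvd' (by omega)).mp h'
      have := Nat.le_of_dvd (by omega) this
      omega
    · rw [path_succ N hv, path_succ N hv]
      exact ih _ j (by omega) (by omega)

end Network

/-- The state of a node in `pathAlgorithm`. -/
structure PathState where
  input : LocalInput
  /-- the number of rounds so far -/
  time : ℕ
  /-- the messages received from the parent so far -/
  log : ℕ → List Bool

/-- The algorithm that forwards along each edge away from the root the entries of the path towards
the root, one in each round, until each node knows the first `T n` entries, and then applies the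
function `out` to them. -/
noncomputable def pathAlgorithm {δ : ℕ} {L : Type} (hδ : 0 < δ) (M T : ℕ → ℕ) (K : ℕ)
    (out : ℕ → (ℕ → ℕ × Fin δ) → L) : Algorithm δ L where
  State := PathState
  init inp := ⟨inp, 0, fun _ => []⟩
  send s q := match q, s.time with
    | none, _ => []
    | some i, 0 => encode (s.input.ident, i)
    | some _, t + 1 => s.log t
  -- Only the root receives nothing from a parent; it generates its virtual entries itself.
  update s inbox := ⟨s.input, s.time + 1, Function.update s.log s.time
    ((inbox none).getD (encode (virtualEntry hδ (M s.input.n) K s.time)))⟩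
  -- The cutoff hides all entries logged after time `T`, which makes the output irrevocable.
  output s := if T s.input.n ≤ s.time then
      some (out s.input.n fun j => if j < T s.input.n then decode hδ (s.log j) else (0, ⟨0, hδ⟩))
    else none
  output_stable s inbox a h := by
    split_ifs at h with ht
    · rw [← h, if_pos (by simpa using ht.trans (Nat.le_succ _))]
      congr 2
      funext j
      dsimp only
      split_ifs with hj
      · rw [Function.update_of_ne (by omega)]
      · rfl

section Run

variable {δ : ℕ} {L V : Type} [Fintype V] (N : Network δ V) {hδ : 0 < δ} {M T : ℕ → ℕ} {K : ℕ}
  {out : ℕ → (ℕ → ℕ × Fin δ) → L}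

theorem pathAlgorithm_send_zero {s : PathState} (h : s.time = 0) (i : Fin δ) :
    (pathAlgorithm hδ M T K out).send s (some i) = encode (s.input.ident, i) := by
  simp [pathAlgorithm, h]

theorem pathAlgorithm_send_succ {s : PathState} {t : ℕ} (h : s.time = t + 1) (i : Fin δ) :
    (pathAlgorithm hδ M T K out).send s (some i) = s.log t := by
  simp [pathAlgorithm, h]

/-- Entry `j + 1` of a node is entry `j` of its parent, logged one round earlier, so forwarding the
newest entry in each round suffices. -/
theorem pathAlgorithm_state (t : ℕ) (v : V) :
    (N.state (pathAlgorithm hδ M T K out) t v).input = N.localInput v ∧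
    (N.state (pathAlgorithm hδ M T K out) t v).time = t ∧
    ∀ j < t, (N.state (pathAlgorithm hδ M T K out) t v).log j =
      encode (N.path hδ (M (Fintype.card V)) K j v) := by
  induction t generalizing v with
  | zero => exact ⟨rfl, rfl, fun j hj => absurd hj (Nat.not_lt_zero j)⟩
  | succ t ih =>
    obtain ⟨h₁, h₂, h₃⟩ := ih v
    refine ⟨h₁, congrArg (· + 1) h₂, fun j hj => ?_⟩
    change Function.update (N.state (pathAlgorithm hδ M T K out) t v).log
      (N.state (pathAlgorithm hδ M T K out) t v).time
      (((N.neighbor v none).map fun w => (pathAlgorithm hδ M T K out).send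
        (N.state (pathAlgorithm hδ M T K out) t w) (N.reversePort v none)).getD
        (encode (virtualEntry hδ (M (N.state (pathAlgorithm hδ M T K out) t v).input.n) K
          (N.state (pathAlgorithm hδ M T K out) t v).time))) j = _
    rcases (Nat.lt_succ_iff_lt_or_eq.mp hj) with hj | rfl
    · rw [Function.update_of_ne (by omega)]
      exact h₃ j hj
    · rw [h₂, Function.update_self, h₁]
      by_cases hv : v = N.tree.root
      · subst hv
        rw [N.path_root]
        simp [Network.neighbor, Network.localInput]
      · simp only [Network.neighbor, hv, if_false, Option.map_some, Option.getD_some,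
          Network.reversePort]
        obtain ⟨g₁, g₂, g₃⟩ := ih (N.tree.parent v)
        cases j with
        | zero => rw [pathAlgorithm_send_zero g₂, g₁, N.path_zero hv]; rfl
        | succ j => rw [pathAlgorithm_send_succ g₂, N.path_succ hv, g₃ j (Nat.lt_succ_self j)]

theorem length_pathAlgorithm_send_le (hM : ∀ v, N.ident v ≤ M (Fintype.card V)) (hK : 0 < K)
    (t : ℕ) (v : V) (q : Port δ) :
    ((pathAlgorithm hδ M T K out).send (N.state (pathAlgorithm hδ M T K out) t v) q).length ≤
      ((M (Fintype.card V) + K + 1) * δ).size := by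
  obtain ⟨h₁, h₂, h₃⟩ := pathAlgorithm_state N (hδ := hδ) (M := M) (T := T) (K := K) (out := out) t v
  cases q with
  | none => exact Nat.zero_le _
  | some i =>
    cases t with
    | zero =>
      rw [pathAlgorithm_send_zero h₂, h₁]
      exact length_encode_le ((hM v).trans (Nat.le_add_right _ _))
    | succ t =>
      rw [pathAlgorithm_send_succ h₂, h₃ t (Nat.lt_succ_self t)]
      exact length_encode_le (N.path_fst_le hM hK t v)

theorem pathAlgorithm_output (v : V) :
    (pathAlgorithm hδ M T K out).output
      (N.state (pathAlgorithm hδ M T K out) (T (Fintype.card V)) v) =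
    some (out (Fintype.card V) fun j => if j < T (Fintype.card V) then
      N.path hδ (M (Fintype.card V)) K j v else (0, ⟨0, hδ⟩)) := by
  obtain ⟨h₁, h₂, h₃⟩ := pathAlgorithm_state N (hδ := hδ) (M := M) (T := T) (K := K) (out := out)
    (T (Fintype.card V)) v
  have h₄ : (N.state (pathAlgorithm hδ M T K out) (T (Fintype.card V)) v).input.n =
      Fintype.card V := by rw [h₁]; rfl
  change (if T (N.state (pathAlgorithm hδ M T K out) (T (Fintype.card V)) v).input.n ≤
      (N.state (pathAlgorithm hδ M T K out) (T (Fintype.card V)) v).time then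
    some (out (N.state (pathAlgorithm hδ M T K out) (T (Fintype.card V)) v).input.n fun j =>
      if j < T (N.state (pathAlgorithm hδ M T K out) (T (Fintype.card V)) v).input.n then
        decode hδ ((N.state (pathAlgorithm hδ M T K out) (T (Fintype.card V)) v).log j)
      else (0, ⟨0, hδ⟩)) else none) = _
  rw [h₂, h₄, if_pos le_rfl]
  congr 2
  funext j
  split_ifs with hj
  · rw [h₃ j hj, decode_encode]
  · rfl

end Run

/-- A problem is solvable if it has blocks of all sufficiently large depths. -/
theorem solvableInCongest_of_isBlock {δ : ℕ} (hδ : 0 < δ) {L : Type} {P : LCL δ L} {S : Set L}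
    {a : L} (ha : a ∈ S) {K : ℕ} (h : ∀ k, K ≤ k → ∃ F, IsBlock P S k F) :
    P.SolvableInCongest (fun n => (logStar n : ℝ)) := by
  intro p
  have : Nonempty L := ⟨a⟩
  obtain ⟨K, hK, h⟩ : ∃ K, 0 < K ∧ ∀ k, K ≤ k → ∃ F, IsBlock P S k F :=
    ⟨K + 1, K.succ_pos, fun k hk => h k (by omega)⟩
  choose! F hF using h
  -- Virtual identifiers exceed `p.eval n` by up to `K`.
  obtain ⟨Q, hQ⟩ := exists_reduce_bound (p + Polynomial.C K)
  simp only [Polynomial.eval_add, Polynomial.eval_C] at hQ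
  refine ⟨pathAlgorithm hδ (fun n => p.eval n) (fun n => pathLength K Q (logStar n)) K
    (fun n => pathLabel F a K Q (logStar n)), fun n => pathLength K Q (logStar n),
    fun n => ((p.eval n + K + 1) * δ).size, isBigO_affine_logStar _ K, ?_, ?_⟩
  · simpa using isBigO_size_eval ((p + Polynomial.C K + 1) * Polynomial.C δ)
  · intro V _ N _ hident
    have hM : ∀ v, N.ident v ≤ p.eval (Fintype.card V) := fun v => (hident v).2
    refine ⟨fun t v _ q _ => length_pathAlgorithm_send_le N (M := fun n => p.eval n) hM hK t v q,
      fun v => pathLabel F a K Q (logStar (Fintype.card V))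
        fun j => N.path hδ (p.eval (Fintype.card V)) K j v, fun v => ?_, ?_⟩
    · refine (pathAlgorithm_output N v).trans (congrArg some (pathLabel_congr hK fun i hi => ?_))
      exact if_pos hi
    · intro v child
      -- The given enumeration of the children may differ from the port numbering; the two are
      -- related by the permutation `π`.
      have hinj : Function.Injective fun i => N.port (child i) := fun i j hij =>
        child.injective (Subtype.ext (N.port_injective v _ _ (child i).2 (child j).2 hij))
      let π : Equiv.Perm (Fin δ) := Equiv.ofBijective _ (Finite.injective_iff_bijective.mp hinj)
      have key := pathLabel_allows (P := P) ha hK hF (hQ (Fintype.card V))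
        (x := fun j => N.path hδ (p.eval (Fintype.card V)) K j v)
        (y := fun i j => N.path hδ (p.eval (Fintype.card V)) K j (child (π.symm i)))
        (fun i => N.path_fst_le hM hK i v) (fun i j => N.path_fst_le hM hK j _)
        (N.path_fst_ne hM v) (fun i => N.path_fst_ne hM _)
        (fun i j => by
          obtain ⟨hne, hpar⟩ := (child (π.symm i)).2
          rw [N.path_succ hne, hpar])
        (fun i => by
          obtain ⟨hne, hpar⟩ := (child (π.symm i)).2
          rw [N.path_zero hne]
          exact π.apply_symm_apply i)
      simpa using key.comp_perm π

end TreeLCL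

theorem mainTheorem4 {δ : ℕ} (hδ : 0 < δ) {L : Type} [Finite L] (P : TreeLCL.LCL δ L)
    (hP : Nonempty (TreeLCL.UniformCertificate P) ∨ Nonempty (TreeLCL.CoprimeCertificate P)) :
    P.SolvableInCongest (fun n => (TreeLCL.logStar n : ℝ)) := by
  rcases hP with ⟨⟨C⟩⟩ | ⟨⟨C⟩⟩
  · exact TreeLCL.solvableInCongest_of_isBlock hδ (Set.mem_range_self 0) C.exists_isBlock
  · exact TreeLCL.solvableInCongest_of_isBlock hδ (Set.mem_range_self 0) C.exists_isBlock
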